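/- Theorem 2.5. For every $\varepsilon_0\in(0,1/e)$ there are a constant $C>0$ and functions $n_o(\varepsilon),n_s(\varepsilon)\in\mathbb N$, $M(T)\in\mathbb Z$, $N(\varepsilon,\delta),n_\ell(\varepsilon,\delta)\in\mathbb N$ (where $C$ and the functions depend only on $\varepsilon_0$) such that the following holds for all $0<\varepsilon\le\varepsilon_0$, $0<\delta\le1$ and $T\ge1$. (a) $n_o\le C\log\frac1\varepsilon$, $n_s\le C\log\frac1\varepsilon$, $M\le0$ and $|M|\le C\log T$, $N\le C\left(\log\log\frac1\varepsilon+\log\frac1\delta\right)$, $n_\ell\le C\left(\log\frac1\varepsilon+\log\frac1\delta\right)$. (b) For $\beta\in(1,2)$ let $s_{o,k},w_{o,k}$ ($1\le k\le n_o$) be the nodes and weights of the $n_o$-point Gauss–Jacobi quadrature with weight function $s^{\beta-1}$ on $[0,2^M]$. Let $s_{j,k},w_{j,k}$ be those of the Gauss–Legendre quadrature on $[2^j,2^{j+1}]$, with $n_s$ points for $j=M,\dots,-1$ (no such $j$ if $M=0$) and with $n_\ell$ points for $j=0,\dots,N$. Then for all $\beta\in(1,2)$ and all $t\in[\delta,T]$,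 $$\left|\frac{\Gamma(\beta)}{t^{\beta}}-\left(\sum_{k=1}^{n_o}e^{-s_{o,k}t}w_{o,k}+\sum_{j=M}^{-1}\sum_{k=1}^{n_s}e^{-s_{j,k}t}s_{j,k}^{\beta-1}w_{j,k}+\sum_{j=0}^{N}\sum_{k=1}^{n_\ell}e^{-s_{j,k}t}s_{j,k}^{\beta-1}w_{j,k}\right)\right|\le\varepsilon .$$ (c) The total number $n_o+|M|\,n_s+(N+1)\,n_\ell$ of exponentials in (b) is at most $C\,R(\varepsilon,\delta,T)$, where $$R(\varepsilon,\delta,T)=\log\tfrac1\varepsilon\left(\log\log\tfrac1\varepsilon+\log\tfrac T\delta\right)+\log\tfrac1\delta\left(\log\log\tfrac1\varepsilon+\log\tfrac1\delta\right).$$ (d) For every $\alpha\in(0,1)$ there are an integer $0\le N_{\exp}\le C\,R(\varepsilon,\delta,T)$ and positive reals $s_i,w_i$ ($1\le i\le N_{\exp}$) with $\left|t^{-1-\alpha}-\sum_{i=1}^{N_{\exp}}w_ie^{-s_it}\right|\le\varepsilon$ for all $t\in[\delta,T]$. -/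

import Mathlib

namespace GaussSOE

/-- The weighted inner product `∫ₐᵇ ω(s) p(s) q(s) ds` of two real polynomials. -/
noncomputable def polyInner (ω : ℝ → ℝ) (a b : ℝ) (p q : Polynomial ℝ) : ℝ :=
  ∫ s in a..b, ω s * (p.eval s * q.eval s)

/-- The monic orthogonal polynomial of degree `n` for the weight function `ω` on `[a, b]`, obtained
from the monomials by Gram-Schmidt orthogonalization. -/
noncomputable def orthoPoly (ω : ℝ → ℝ) (a b : ℝ) (n : ℕ) : Polynomial ℝ :=
  Polynomial.X ^ n - ∑ k : Fin n,
    Polynomial.C (polyInner ω a b (Polynomial.X ^ n) (orthoPoly ω a b k.1) /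
      polyInner ω a b (orthoPoly ω a b k.1) (orthoPoly ω a b k.1)) * orthoPoly ω a b k.1
termination_by n
decreasing_by exact k.2

/-- The nodes of the `n`-point Gauss quadrature for the weight function `ω` on `[a, b]`: the zeros
of the orthogonal polynomial of degree `n`. (For a positive integrable weight on a nondegenerate
interval these are `n` distinct points of `(a, b)`.) -/
noncomputable def gaussNodes (ω : ℝ → ℝ) (a b : ℝ) (n : ℕ) : Finset ℝ :=
  (orthoPoly ω a b n).roots.toFinset

/-- The weight of the `n`-point Gauss quadrature at the node `x`: the weighted integral of the
Lagrange basis polynomial which is `1` at `x` and `0` at the other nodes. -/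
noncomputable def gaussWeight (ω : ℝ → ℝ) (a b : ℝ) (n : ℕ) (x : ℝ) : ℝ :=
  ∫ s in a..b, ω s * (Lagrange.basis (gaussNodes ω a b n) id x).eval s

/-- The `n`-point Gauss-Legendre quadrature (weight function `1`) on `[a, b]`, applied to `f`. -/
noncomputable def gaussLegendre (a b : ℝ) (n : ℕ) (f : ℝ → ℝ) : ℝ :=
  ∑ x ∈ gaussNodes (fun _ => 1) a b n, f x * gaussWeight (fun _ => 1) a b n x

/-- The `n`-point Gauss-Jacobi quadrature with weight function `s ^ (β - 1)` on `[0, a]`, applied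
to `f`. It approximates `∫₀ᵃ f(s) s ^ (β - 1) ds`. -/
noncomputable def gaussJacobi (β a : ℝ) (n : ℕ) (f : ℝ → ℝ) : ℝ :=
  ∑ x ∈ gaussNodes (fun s => s ^ (β - 1)) 0 a n,
    f x * gaussWeight (fun s => s ^ (β - 1)) 0 a n x

/-- The combined discretization of `∫₀^∞ e ^ (-t s) s ^ (β - 1) ds`: Gauss-Jacobi with `nO` points
on `[0, 2 ^ M]`, Gauss-Legendre with `nS` points on `[2 ^ j, 2 ^ (j + 1)]` for `M ≤ j ≤ -1`, and
Gauss-Legendre with `nL` points on `[2 ^ j, 2 ^ (j + 1)]` for `0 ≤ j ≤ N`. -/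
noncomputable def combinedRule (β : ℝ) (nO : ℕ) (M : ℤ) (nS N nL : ℕ) (t : ℝ) : ℝ :=
  gaussJacobi β ((2 : ℝ) ^ M) nO (fun s => Real.exp (-s * t))
  + ∑ j ∈ Finset.Icc M (-1),
      gaussLegendre ((2 : ℝ) ^ j) ((2 : ℝ) ^ (j + 1)) nS
        (fun s => Real.exp (-s * t) * s ^ (β - 1))
  + ∑ j ∈ Finset.range (N + 1),
      gaussLegendre ((2 : ℝ) ^ j) ((2 : ℝ) ^ (j + 1)) nL
        (fun s => Real.exp (-s * t) * s ^ (β - 1))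

/-- The number of exponentials in `combinedRule` when `M ≤ 0`: there are `|M|` small and `N + 1`
large intervals. -/
def numExp (nO : ℕ) (M : ℤ) (nS N nL : ℕ) : ℕ :=
  nO + M.natAbs * nS + (N + 1) * nL

/-- `log(1/ε) (log log(1/ε) + log(T/δ)) + log(1/δ) (log log(1/ε) + log(1/δ))`. -/
noncomputable def expRate (ε δ T : ℝ) : ℝ :=
  Real.log (1 / ε) * (Real.log (Real.log (1 / ε)) + Real.log (T / δ))
  + Real.log (1 / δ) * (Real.log (Real.log (1 / ε)) + Real.log (1 / δ))

end GaussSOE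

/-! Write Γ(β)/t^β as the Laplace integral of s^(β-1) e^(-ts) over (0, ∞) and cut it at powers of 2,
from about 1/T up to a truncation point (`Gamma_div_rpow_eq_dyadic`).

Gauss rules are exact on polynomials of degree below 2n and have positive weights, so their error is
at most twice the uniform polynomial approximation error times the mass of the weight
(`abs_integral_sub_gauss_le`). On [r, 2r] the integrand is holomorphic on the disc of centre 3r/2
and radius r. This disc lies in the right half-plane, so the exponential has modulus at most 1
there, whatever t ≥ 0 is, and Taylor polynomials give the error 10 r^β 2^(-n)
(`gaussLegendre_error`). Near 0 the Jacobi weight absorbs the singular power; what remains is entire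
and bounded because the interval has length at most 2/t.

As β > 1, the factors r^β are summable over the intervals below 1, so `nS` need not depend on T. As
β < 2, they cost at most a multiple of 4^N above 1, which 2N extra nodes pay for. The tail is small
once 2^N δ exceeds log(1/ε) + 2 log(1/δ) + log 16.

The hypothesis ε₀ < 1/e keeps log log(1/ε) above a positive c, so that additive constants fit into
the rate. Part (d) divides by Γ(1+α) ≥ 1/2; positivity of nodes and weights gives positive exponents
and coefficients. -/

namespace GaussSOE

/-! ### Gauss quadrature for a continuous positive weight -/

section GaussQuadrature

open Polynomial

variable {ω : ℝ → ℝ} {a b : ℝ}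

theorem intervalIntegrable_weight_mul_eval (hω : Continuous ω) (p : ℝ[X]) :
    IntervalIntegrable (fun s => ω s * p.eval s) MeasureTheory.volume a b :=
  (hω.mul p.continuous).intervalIntegrable a b

/-- A nonzero polynomial has finitely many zeros, so the integrand is positive somewhere. Positivity
of the weight is asked only on the open interval because s^(β-1) vanishes at 0. -/
theorem integral_weight_mul_eval_pos (hω : Continuous ω) (hab : a < b)
    (hpos : ∀ s ∈ Set.Ioo a b, 0 < ω s) {p : ℝ[X]} (hp : p ≠ 0)
    (hnn : ∀ s ∈ Set.Ioo a b, 0 ≤ p.eval s) : 0 < ∫ s in a..b, ω s * p.eval s := by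
  have hcont : Continuous fun s => ω s * p.eval s := hω.mul p.continuous
  have hcl : ∀ s ∈ Set.Icc a b, 0 ≤ ω s * p.eval s := by
    rw [← closure_Ioo hab.ne]
    exact (isClosed_Ici.preimage hcont).closure_subset_iff.2
      fun s hs => mul_nonneg (hpos s hs).le (hnn s hs)
  obtain ⟨c, hc, hcr⟩ : ∃ c ∈ Set.Ioo a b, p.eval c ≠ 0 := by
    by_contra! h
    exact hp (p.eq_zero_of_infinite_isRoot ((Set.Ioo_infinite hab).mono h))
  refine intervalIntegral.integral_pos hab hcont.continuousOn
    (fun s hs => hcl s ⟨hs.1.le, hs.2⟩) ⟨c, Set.Ioo_subset_Icc_self hc, ?_⟩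
  exact mul_pos (hpos c hc) (lt_of_le_of_ne (hnn c hc) (Ne.symm hcr))

theorem polyInner_eq_integral_mul (p q : ℝ[X]) :
    polyInner ω a b p q = ∫ s in a..b, ω s * (p * q).eval s := by
  simp [polyInner]

theorem polyInner_comm (p q : ℝ[X]) : polyInner ω a b p q = polyInner ω a b q p := by
  rw [polyInner_eq_integral_mul, polyInner_eq_integral_mul, mul_comm]

theorem polyInner_add_right (hω : Continuous ω) (p q r : ℝ[X]) :
    polyInner ω a b p (q + r) = polyInner ω a b p q + polyInner ω a b p r := by
  simp only [polyInner_eq_integral_mul]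
  rw [← intervalIntegral.integral_add (intervalIntegrable_weight_mul_eval hω _)
    (intervalIntegrable_weight_mul_eval hω _)]
  simp only [mul_add, eval_add]

theorem polyInner_C_mul_right (c : ℝ) (p q : ℝ[X]) :
    polyInner ω a b p (C c * q) = c * polyInner ω a b p q := by
  simp only [polyInner]
  rw [← intervalIntegral.integral_const_mul]
  congr 1 with s
  simp
  ring

/-- `polyInner` as a linear map in its second argument. -/
noncomputable def polyInnerLin (a b : ℝ) (hω : Continuous ω) (p : ℝ[X]) : ℝ[X] →ₗ[ℝ] ℝ where
  toFun := polyInner ω a b p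
  map_add' := polyInner_add_right hω p
  map_smul' c q := by
    rw [smul_eq_C_mul, polyInner_C_mul_right]; rfl

theorem polyInnerLin_apply (hω : Continuous ω) (p q : ℝ[X]) :
    polyInnerLin a b hω p q = polyInner ω a b p q := rfl

theorem polyInner_self_pos (hω : Continuous ω) (hab : a < b)
    (hpos : ∀ s ∈ Set.Ioo a b, 0 < ω s) {p : ℝ[X]} (hp : p ≠ 0) :
    0 < polyInner ω a b p p := by
  rw [polyInner_eq_integral_mul]
  refine integral_weight_mul_eval_pos hω hab hpos (mul_ne_zero hp hp) fun s _ => ?_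
  rw [eval_mul]
  exact mul_self_nonneg _

theorem sum_projections_degree_lt (n : ℕ)
    (h : ∀ k < n, (orthoPoly ω a b k).degree ≤ k) :
    (∑ k : Fin n, C (polyInner ω a b (X ^ n) (orthoPoly ω a b k.1) /
      polyInner ω a b (orthoPoly ω a b k.1) (orthoPoly ω a b k.1)) *
        orthoPoly ω a b k.1).degree < n := by
  refine (degree_sum_le _ _).trans_lt ?_
  refine (Finset.sup_lt_iff (WithBot.bot_lt_coe n)).2 fun k _ => ?_
  rw [C_mul']
  exact (degree_smul_le _ _).trans_lt ((h k k.2).trans_lt (Nat.cast_lt.2 k.2))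

theorem orthoPoly_monic_and_degree (n : ℕ) :
    (orthoPoly ω a b n).Monic ∧ (orthoPoly ω a b n).degree = n := by
  induction n using Nat.strong_induction_on with
  | _ n ih =>
    have hlt := sum_projections_degree_lt n fun k hk => (ih k hk).2.le
    rw [orthoPoly]
    refine ⟨(monic_X_pow n).sub_of_left (by rwa [degree_X_pow]), ?_⟩
    rw [degree_sub_eq_left_of_degree_lt (by rwa [degree_X_pow]), degree_X_pow]

theorem orthoPoly_monic (n : ℕ) : (orthoPoly ω a b n).Monic := (orthoPoly_monic_and_degree n).1

theorem orthoPoly_degree (n : ℕ) : (orthoPoly ω a b n).degree = n :=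
  (orthoPoly_monic_and_degree n).2

/-- By induction only the k-th projection in the Gram-Schmidt formula survives pairing with the k-th
polynomial, and it cancels the monomial term. -/
theorem polyInner_orthoPoly_of_lt (hω : Continuous ω) (hab : a < b)
    (hpos : ∀ s ∈ Set.Ioo a b, 0 < ω s) (n : ℕ) :
    ∀ k < n, polyInner ω a b (orthoPoly ω a b k) (orthoPoly ω a b n) = 0 := by
  induction n using Nat.strong_induction_on with
  | _ n ih =>
    intro k hk
    have hself := (polyInner_self_pos hω hab hpos (orthoPoly_monic (ω := ω) (a := a) (b := b) k).ne_zero).ne'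
    rw [orthoPoly.eq_1 ω a b n, ← polyInnerLin_apply hω, map_sub, map_sum,
      Finset.sum_eq_single_of_mem (⟨k, hk⟩ : Fin n) (Finset.mem_univ _)]
    · simp only [polyInnerLin_apply, polyInner_C_mul_right]
      rw [div_mul_cancel₀ _ hself, polyInner_comm, sub_self]
    · intro l _ hl
      rw [polyInnerLin_apply, polyInner_C_mul_right]
      rcases lt_or_gt_of_ne (fun h => hl (Fin.ext h) : l.1 ≠ k) with h | h
      · rw [polyInner_comm (orthoPoly ω a b k), ih k hk l h, mul_zero]
      · rw [ih l l.2 k h, mul_zero]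

theorem polyInner_orthoPoly_of_degree_lt (hω : Continuous ω) (hab : a < b)
    (hpos : ∀ s ∈ Set.Ioo a b, 0 < ω s) (n : ℕ) {q : ℝ[X]} (hq : q.degree < n) :
    polyInner ω a b (orthoPoly ω a b n) q = 0 := by
  -- Induct on the degree bound of q with n fixed, removing the top coefficient with a multiple of
  -- the monic `orthoPoly ω a b m`.
  suffices H : ∀ m ≤ n, ∀ q : ℝ[X], q.degree < m → polyInner ω a b (orthoPoly ω a b n) q = 0 from
    H n le_rfl q hq
  intro m
  induction m with
  | zero =>
    intro _ q hq
    have : q = 0 := by simpa using hq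
    simp [this, polyInner]
  | succ m ih =>
    intro hm q hq
    have key : (q - C (q.coeff m) * orthoPoly ω a b m).degree < m := by
      have hP := orthoPoly_degree (ω := ω) (a := a) (b := b) m
      rw [degree_lt_iff_coeff_zero]
      intro k hk
      rcases hk.eq_or_lt with rfl | hk
      · have h1 : (orthoPoly ω a b m).coeff m = 1 := by
          have := orthoPoly_monic (ω := ω) (a := a) (b := b) m
          rw [Monic, leadingCoeff, natDegree_eq_of_degree_eq_some hP] at this
          exact this
        simp [h1]
      · have h1 : q.coeff k = 0 := (degree_lt_iff_coeff_zero q (m + 1)).1 hq k hk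
        have h2 : (orthoPoly ω a b m).coeff k = 0 :=
          coeff_eq_zero_of_degree_lt (by rw [hP]; exact_mod_cast hk)
        simp [h1, h2]
    have h := ih (by omega) _ key
    rw [← polyInnerLin_apply hω, map_sub, polyInnerLin_apply, polyInnerLin_apply,
      polyInner_C_mul_right, polyInner_comm _ (orthoPoly ω a b m),
      polyInner_orthoPoly_of_lt hω hab hpos n m (by omega), mul_zero, sub_zero] at h
    exact h

/-- Take for S the roots in (a, b) of odd multiplicity: the extra linear factors make all
multiplicities there even. The induction divides out one root at a time and toggles its membership
in S. -/
theorem exists_simple_roots_sign (a b : ℝ) (n : ℕ) :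
    ∀ p : ℝ[X], p ≠ 0 → p.natDegree ≤ n → ∃ S : Finset ℝ,
      (∀ x ∈ S, x ∈ Set.Ioo a b ∧ p.IsRoot x) ∧
      ((∀ s ∈ Set.Ioo a b, 0 ≤ (p * ∏ x ∈ S, (X - C x)).eval s) ∨
        (∀ s ∈ Set.Ioo a b, (p * ∏ x ∈ S, (X - C x)).eval s ≤ 0)) := by
  induction n with
  | zero =>
    intro p _ hn
    refine ⟨∅, by simp, ?_⟩
    rw [eq_C_of_natDegree_le_zero hn]
    rcases le_total 0 (p.coeff 0) with h | h
    · exact Or.inl fun s _ => by simpa using h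
    · exact Or.inr fun s _ => by simpa using h
  | succ n ih =>
    intro p hp hn
    by_cases hroot : ∃ x ∈ Set.Ioo a b, p.IsRoot x
    · obtain ⟨x, hx, hxr⟩ := hroot
      obtain ⟨p', rfl⟩ := dvd_iff_isRoot.2 hxr
      have hp' : p' ≠ 0 := right_ne_zero_of_mul hp
      have hdeg : p'.natDegree ≤ n := by
        rw [natDegree_mul (X_sub_C_ne_zero x) hp', natDegree_X_sub_C] at hn
        omega
      obtain ⟨S, hS, hsign⟩ := ih p' hp' hdeg
      have hroots : ∀ y ∈ S, y ∈ Set.Ioo a b ∧ ((X - C x) * p').IsRoot y := fun y hy =>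
        ⟨(hS y hy).1, root_mul_left_of_isRoot _ (hS y hy).2⟩
      by_cases hxS : x ∈ S
      · refine ⟨S.erase x, fun y hy => hroots y (Finset.mem_of_mem_erase hy), ?_⟩
        have : (X - C x) * p' * ∏ y ∈ S.erase x, (X - C y) = p' * ∏ y ∈ S, (X - C y) := by
          rw [← Finset.mul_prod_erase S _ hxS]; ring
        rwa [this]
      · refine ⟨insert x S, ?_, ?_⟩
        · intro y hy
          rcases Finset.mem_insert.1 hy with rfl | hy
          · exact ⟨hx, hxr⟩
          · exact hroots y hy
        · have : (X - C x) * p' * ∏ y ∈ insert x S, (X - C y)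
              = (X - C x) ^ 2 * (p' * ∏ y ∈ S, (X - C y)) := by
            rw [Finset.prod_insert hxS]; ring
          rw [this]
          refine hsign.imp (fun h s hs => ?_) (fun h s hs => ?_)
          · rw [eval_mul, eval_pow]
            exact mul_nonneg (sq_nonneg _) (h s hs)
          · rw [eval_mul, eval_pow]
            exact mul_nonpos_of_nonneg_of_nonpos (sq_nonneg _) (h s hs)
    · refine ⟨∅, by simp, ?_⟩
      push Not at hroot
      simp only [Finset.prod_empty, mul_one]
      by_contra! h
      obtain ⟨⟨s, hs, hs'⟩, ⟨r, hr, hr'⟩⟩ := h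
      obtain ⟨c, hc, hc0⟩ := (isPreconnected_Ioo (a := a) (b := b)).intermediate_value hs hr
        p.continuous.continuousOn ⟨hs'.le, hr'.le⟩
      exact hroot c hc hc0

/-- With fewer than n sign changes in (a, b), the product of the corresponding linear factors would
be orthogonal to the n-th orthogonal polynomial, although their product has constant sign and hence
a nonzero integral. -/
theorem gaussNodes_card_and_mem (hω : Continuous ω) (hab : a < b)
    (hpos : ∀ s ∈ Set.Ioo a b, 0 < ω s) (n : ℕ) :
    (gaussNodes ω a b n).card = n ∧ ∀ x ∈ gaussNodes ω a b n, x ∈ Set.Ioo a b := by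
  have hP := orthoPoly_monic (ω := ω) (a := a) (b := b) n
  have hdeg := orthoPoly_degree (ω := ω) (a := a) (b := b) n
  have hnat := natDegree_eq_of_degree_eq_some hdeg
  obtain ⟨S, hS, hsign⟩ := exists_simple_roots_sign a b n _ hP.ne_zero hnat.le
  have hsub : S ⊆ gaussNodes ω a b n := fun x hx => by
    rw [gaussNodes, Multiset.mem_toFinset, mem_roots hP.ne_zero]
    exact (hS x hx).2
  have hle : (gaussNodes ω a b n).card ≤ n :=
    (Multiset.toFinset_card_le _).trans ((card_roots' _).trans hnat.le)
  have hge : n ≤ S.card := by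
    by_contra! hlt
    have hmonic : (∏ x ∈ S, (X - C x : ℝ[X])).Monic := monic_prod_of_monic _ _ fun x _ => monic_X_sub_C x
    have hqdeg : (∏ x ∈ S, (X - C x : ℝ[X])).degree < n := by
      rw [degree_prod]
      simpa using hlt
    have hzero := polyInner_orthoPoly_of_degree_lt hω hab hpos n hqdeg
    rw [polyInner_eq_integral_mul] at hzero
    have hne := mul_ne_zero hP.ne_zero hmonic.ne_zero
    rcases hsign with h | h
    · exact (integral_weight_mul_eval_pos hω hab hpos hne h).ne' hzero
    · have := integral_weight_mul_eval_pos hω hab hpos (neg_ne_zero.2 hne)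
        (fun s hs => by rw [eval_neg]; exact neg_nonneg.2 (h s hs))
      simp only [eval_neg, mul_neg, intervalIntegral.integral_neg, hzero, neg_zero, lt_irrefl]
        at this
  have heq : S = gaussNodes ω a b n := Finset.eq_of_subset_of_card_le hsub (hle.trans hge)
  refine ⟨le_antisymm hle (hge.trans (Finset.card_le_card hsub)), fun x hx => ?_⟩
  rw [← heq] at hx
  exact (hS x hx).1

/-- Divide p by the orthogonal polynomial P. The quotient has degree below n, so its product with P
integrates to 0; the remainder agrees with p at the nodes and equals its Lagrange interpolant. -/
theorem gauss_exact (hω : Continuous ω) (hab : a < b) (hpos : ∀ s ∈ Set.Ioo a b, 0 < ω s)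
    (n : ℕ) {p : ℝ[X]} (hp : p.degree < (2 * n : ℕ)) :
    ∫ s in a..b, ω s * p.eval s = ∑ x ∈ gaussNodes ω a b n, p.eval x * gaussWeight ω a b n x := by
  have hP := orthoPoly_monic (ω := ω) (a := a) (b := b) n
  have hdeg := orthoPoly_degree (ω := ω) (a := a) (b := b) n
  have hcard := (gaussNodes_card_and_mem hω hab hpos n).1
  set P := orthoPoly ω a b n with hPdef
  have hq : (p /ₘ P).degree < n := by
    rcases eq_or_ne (p /ₘ P) 0 with h0 | h0
    · rw [h0, degree_zero]; exact WithBot.bot_lt_coe n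
    · have hp0 : p ≠ 0 := by
        rintro rfl; simp at h0
      rw [← natDegree_lt_iff_degree_lt h0, natDegree_divByMonic _ hP,
        natDegree_eq_of_degree_eq_some hdeg]
      have := (natDegree_lt_iff_degree_lt hp0).2 hp
      by_contra! hcon
      omega
  have hr : (p %ₘ P).degree < n := hdeg ▸ degree_modByMonic_lt p hP
  have hroot : ∀ x ∈ gaussNodes ω a b n, (p %ₘ P).eval x = p.eval x := fun x hx => by
    have hx0 : P.eval x = 0 := by
      rw [gaussNodes, Multiset.mem_toFinset, mem_roots hP.ne_zero] at hx
      exact hx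
    conv_rhs => rw [← modByMonic_add_div p P]
    simp [hx0]
  have hint : p %ₘ P = Lagrange.interpolate (gaussNodes ω a b n) id fun x => (p %ₘ P).eval x :=
    Lagrange.eq_interpolate (Function.injective_id.injOn) (by rwa [hcard])
  have hsplit : ∫ s in a..b, ω s * p.eval s = ∫ s in a..b, ω s * (p %ₘ P).eval s := by
    have h0 := polyInner_orthoPoly_of_degree_lt hω hab hpos n hq
    rw [polyInner_eq_integral_mul] at h0
    conv_lhs => rw [← modByMonic_add_div p P]
    simp only [eval_add, mul_add]
    rw [intervalIntegral.integral_add (intervalIntegrable_weight_mul_eval hω _)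
      (intervalIntegrable_weight_mul_eval hω _), h0, add_zero]
  rw [hsplit, hint, Lagrange.interpolate_apply]
  simp only [eval_finsetSum, eval_mul, eval_C, Finset.mul_sum]
  rw [intervalIntegral.integral_finsetSum fun x _ => ?_]
  · refine Finset.sum_congr rfl fun x hx => ?_
    rw [hroot x hx, gaussWeight, ← intervalIntegral.integral_const_mul]
    congr 1 with s
    ring
  · exact (hω.mul (continuous_const.mul (Polynomial.continuous _))).intervalIntegrable a b

/-- The square of the Lagrange basis polynomial has degree 2n - 2, so exactness identifies the
weight with its integral. -/
theorem gaussWeight_pos (hω : Continuous ω) (hab : a < b) (hpos : ∀ s ∈ Set.Ioo a b, 0 < ω s)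
    (n : ℕ) {x : ℝ} (hx : x ∈ gaussNodes ω a b n) : 0 < gaussWeight ω a b n x := by
  set ℓ := Lagrange.basis (gaussNodes ω a b n) id x with hℓ
  have hcard := (gaussNodes_card_and_mem hω hab hpos n).1
  have hinj : Set.InjOn id (gaussNodes ω a b n : Set ℝ) := Function.injective_id.injOn
  have hne : ℓ ≠ 0 := Lagrange.basis_ne_zero hinj hx
  have hdeg : (ℓ * ℓ).degree < (2 * n : ℕ) := by
    have h1 : 0 < n := by rw [← hcard]; exact Finset.card_pos.2 ⟨x, hx⟩
    rw [degree_mul, hℓ, Lagrange.degree_basis hinj hx, hcard]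
    norm_cast
    omega
  have h := gauss_exact hω hab hpos n hdeg
  rw [Finset.sum_eq_single_of_mem x hx] at h
  · have hx1 : ℓ.eval x = 1 := Lagrange.eval_basis_self (v := id) hinj hx
    rw [eval_mul, hx1, mul_one, one_mul] at h
    rw [← h]
    refine integral_weight_mul_eval_pos hω hab hpos (mul_ne_zero hne hne) fun s _ => ?_
    rw [eval_mul]
    exact mul_self_nonneg _
  · intro y hy hyx
    have : ℓ.eval y = 0 := Lagrange.eval_basis_of_ne (v := id) hyx.symm hy
    simp [this]

theorem sum_gaussWeight (hω : Continuous ω) (hab : a < b) (hpos : ∀ s ∈ Set.Ioo a b, 0 < ω s)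
    {n : ℕ} (hn : 0 < n) :
    ∑ x ∈ gaussNodes ω a b n, gaussWeight ω a b n x = ∫ s in a..b, ω s := by
  have h := gauss_exact hω hab hpos n (p := 1) (by
    rw [degree_one]; exact_mod_cast (by omega : 0 < 2 * n))
  simpa using h.symm

/-- The error of Gauss quadrature is controlled by uniform polynomial approximation. -/
theorem abs_integral_sub_gauss_le (hω : Continuous ω) (hab : a < b)
    (hpos : ∀ s ∈ Set.Ioo a b, 0 < ω s) {n : ℕ} (hn : 0 < n) {f : ℝ → ℝ} (hf : Continuous f)
    {p : ℝ[X]} (hp : p.degree < n) {η : ℝ} (hη : ∀ s ∈ Set.Icc a b, |f s - p.eval s| ≤ η) :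
    |(∫ s in a..b, ω s * f s) - ∑ x ∈ gaussNodes ω a b n, f x * gaussWeight ω a b n x|
      ≤ 2 * η * ∫ s in a..b, ω s := by
  have hω0 : ∀ s ∈ Set.Icc a b, 0 ≤ ω s := by
    rw [← closure_Ioo hab.ne]
    exact (isClosed_Ici.preimage hω).closure_subset_iff.2 fun s hs => (hpos s hs).le
  have hp' : p.degree < (2 * n : ℕ) := hp.trans_le (by exact_mod_cast (by omega : n ≤ 2 * n))
  have hexact := gauss_exact hω hab hpos n hp'
  have h1 : |(∫ s in a..b, ω s * f s) - ∫ s in a..b, ω s * p.eval s|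
      ≤ η * ∫ s in a..b, ω s := by
    have hωf : Continuous fun s => ω s * f s := hω.mul hf
    rw [← intervalIntegral.integral_sub (hωf.intervalIntegrable a b)
      (intervalIntegrable_weight_mul_eval hω p), ← intervalIntegral.integral_const_mul]
    have hηω : Continuous fun s => η * ω s := continuous_const.mul hω
    rw [← Real.norm_eq_abs]
    refine intervalIntegral.norm_integral_le_of_norm_le hab.le
      (.of_forall fun s hs => ?_) (hηω.intervalIntegrable a b)
    have hs' : s ∈ Set.Icc a b := ⟨hs.1.le, hs.2⟩
    rw [← mul_sub, Real.norm_eq_abs, abs_mul, abs_of_nonneg (hω0 s hs'), mul_comm]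
    exact mul_le_mul_of_nonneg_right (hη s hs') (hω0 s hs')
  -- Positive weights with the same total mass as ω make the rule as stable as the integral.
  have h2 : |(∑ x ∈ gaussNodes ω a b n, p.eval x * gaussWeight ω a b n x)
      - ∑ x ∈ gaussNodes ω a b n, f x * gaussWeight ω a b n x| ≤ η * ∫ s in a..b, ω s := by
    rw [← Finset.sum_sub_distrib, ← sum_gaussWeight hω hab hpos hn, Finset.mul_sum]
    refine (Finset.abs_sum_le_sum_abs _ _).trans (Finset.sum_le_sum fun x hx => ?_)
    have hw := (gaussWeight_pos hω hab hpos n hx).le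
    rw [← sub_mul, abs_mul, abs_of_nonneg hw, abs_sub_comm]
    exact mul_le_mul_of_nonneg_right
      (hη x (Set.Ioo_subset_Icc_self ((gaussNodes_card_and_mem hω hab hpos n).2 x hx))) hw
  rw [hexact] at h1
  rw [abs_le] at *
  constructor <;> linarith [h1.1, h1.2, h2.1, h2.2]

end GaussQuadrature


/-! ### Polynomial approximation of holomorphic functions -/

section Taylor

open Polynomial

/-- A function bounded by `B` on a disc of radius `R` is approximated at a geometric rate by its
Taylor polynomials on the disc of half the radius. -/
theorem exists_polynomial_approx {f : ℂ → ℂ} {c R B : ℝ} (hR : 0 < R)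
    (hf : DifferentiableOn ℂ f (Metric.closedBall (c : ℂ) R))
    (hB : ∀ z ∈ Metric.closedBall (c : ℂ) R, ‖f z‖ ≤ B) (n : ℕ) :
    ∃ p : ℝ[X], p.degree < n ∧
      ∀ x : ℝ, |x - c| ≤ R / 2 → |(f x).re - p.eval x| ≤ 2 * B * (1 / 2) ^ n := by
  set d : ℕ → ℂ := fun k => (k.factorial : ℂ)⁻¹ * iteratedDeriv k f c with hd
  -- Since x - c is real, the real part of the Taylor polynomial only involves the real parts of its
  -- coefficients.
  refine ⟨∑ k ∈ Finset.range n, C (d k).re * (X - C c) ^ k, ?_, fun x hx => ?_⟩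
  · refine (degree_sum_le _ _).trans_lt ((Finset.sup_lt_iff (WithBot.bot_lt_coe n)).2 fun k hk => ?_)
    rw [C_mul']
    refine (degree_smul_le _ _).trans_lt ?_
    rw [degree_pow, degree_X_sub_C, nsmul_eq_mul, mul_one]
    exact Nat.cast_lt.2 (Finset.mem_range.1 hk)
  -- Cauchy's estimates.
  have hdk : ∀ k, ‖d k‖ ≤ B / R ^ k := fun k => by
    have h := Complex.norm_iteratedDeriv_le_of_forall_mem_sphere_norm_le k hR
      (hf.diffContOnCl_ball subset_rfl) fun z hz => hB z (Metric.sphere_subset_closedBall hz)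
    have hfac : (0 : ℝ) < k.factorial := by exact_mod_cast k.factorial_pos
    rw [hd, norm_mul, norm_inv, Complex.norm_natCast, inv_mul_le_iff₀ hfac]
    rwa [mul_div_assoc] at h
  have hB0 : 0 ≤ B := (norm_nonneg _).trans (hB c (Metric.mem_closedBall_self hR.le))
  have hsum := Complex.hasSum_taylorSeries_on_ball (hf.mono Metric.ball_subset_closedBall)
    (z := (x : ℂ)) (by
      rw [Metric.mem_ball, dist_eq_norm, ← Complex.ofReal_sub, Complex.norm_real, Real.norm_eq_abs]
      linarith)
  have hterm : ∀ k : ℕ, ‖(k.factorial : ℂ)⁻¹ • ((x : ℂ) - c) ^ k • iteratedDeriv k f c‖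
      ≤ B * (1 / 2) ^ k := fun k => by
    have : (k.factorial : ℂ)⁻¹ • ((x : ℂ) - c) ^ k • iteratedDeriv k f c
        = d k * ((x - c : ℝ) : ℂ) ^ k := by
      simp only [hd, smul_eq_mul]; push_cast; ring
    rw [this, norm_mul, norm_pow, Complex.norm_real, Real.norm_eq_abs]
    calc ‖d k‖ * |x - c| ^ k ≤ B / R ^ k * (R / 2) ^ k := by
          gcongr
          exact hdk k
      _ = B * (1 / 2) ^ k := by
          rw [div_pow, div_pow, one_pow]; field_simp
  have h := norm_sub_le_of_geometric_bound_of_hasSum (by norm_num) hterm hsum n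
  have hre : (f x).re - (∑ k ∈ Finset.range n, C (d k).re * (X - C c) ^ k).eval x
      = -((∑ k ∈ Finset.range n, (k.factorial : ℂ)⁻¹ • ((x : ℂ) - c) ^ k • iteratedDeriv k f c)
        - f x).re := by
    rw [Complex.sub_re, Complex.re_sum, eval_finsetSum, neg_sub]
    congr 1
    refine Finset.sum_congr rfl fun k _ => ?_
    have : (k.factorial : ℂ)⁻¹ • ((x : ℂ) - c) ^ k • iteratedDeriv k f c
        = d k * (((x - c) ^ k : ℝ) : ℂ) := by
      simp only [hd, smul_eq_mul]; push_cast; ring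
    rw [this, Complex.re_mul_ofReal]
    simp
  rw [hre, abs_neg]
  refine (Complex.abs_re_le_norm _).trans (h.trans (le_of_eq ?_))
  ring

end Taylor

/-! ### Quadrature error on one interval, and the tail -/

section LocalErrors

theorem continuous_exp_mul_rpow {β : ℝ} (hβ : 1 < β) (t : ℝ) :
    Continuous fun s : ℝ => Real.exp (-s * t) * s ^ (β - 1) :=
  (by fun_prop : Continuous fun s : ℝ => Real.exp (-s * t)).mul
    (Real.continuous_rpow_const (by linarith))

/-- The Gauss-Legendre error on a dyadic interval, uniformly in `t ≥ 0`. -/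
theorem gaussLegendre_error {β t r : ℝ} (hβ : 1 < β) (hβ' : β < 2) (ht : 0 ≤ t) (hr : 0 < r)
    {n : ℕ} (hn : 0 < n) :
    |(∫ s in r..2 * r, Real.exp (-s * t) * s ^ (β - 1))
      - gaussLegendre r (2 * r) n (fun s => Real.exp (-s * t) * s ^ (β - 1))|
      ≤ 10 * r ^ β * (1 / 2) ^ n := by
  -- The disc of radius r about this centre has real part at least r/2 and modulus at most 5r/2, and
  -- the concentric half-size disc meets the real line exactly in [r, 2r].
  set c : ℝ := 3 / 2 * r with hc
  set f : ℂ → ℂ := fun z => Complex.exp (-z * t) * z ^ ((β - 1 : ℝ) : ℂ) with hf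
  have hre : ∀ z ∈ Metric.closedBall (c : ℂ) r, 0 < z.re := fun z hz => by
    have h1 : |(z - c).re| ≤ r := (Complex.abs_re_le_norm _).trans (by
      rwa [← dist_eq_norm])
    rw [Complex.sub_re, Complex.ofReal_re, abs_le] at h1
    linarith [h1.1]
  have hdiff : DifferentiableOn ℂ f (Metric.closedBall (c : ℂ) r) := fun z hz => by
    have hz' : z ∈ Complex.slitPlane := Or.inl (hre z hz)
    have : DifferentiableAt ℂ f z := by
      refine DifferentiableAt.mul (by fun_prop) ?_
      exact differentiableAt_id.cpow_const hz'
    exact this.differentiableWithinAt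
  have hbound : ∀ z ∈ Metric.closedBall (c : ℂ) r, ‖f z‖ ≤ 5 / 2 * r ^ (β - 1) := fun z hz => by
    have hz0 := hre z hz
    have hzne : z ≠ 0 := by rintro rfl; simp at hz0
    have h1 : ‖Complex.exp (-z * t)‖ ≤ 1 := by
      rw [Complex.norm_exp, Real.exp_le_one_iff]
      simp only [Complex.mul_re, Complex.neg_re, Complex.ofReal_re, Complex.neg_im,
        Complex.ofReal_im, mul_zero, sub_zero]
      nlinarith
    have h2 : ‖z‖ ≤ 5 / 2 * r := by
      have := norm_le_norm_add_norm_sub' z c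
      rw [Metric.mem_closedBall, dist_eq_norm] at hz
      rw [Complex.norm_real, Real.norm_eq_abs, abs_of_pos (by positivity)] at this
      linarith
    rw [hf, norm_mul, Complex.norm_cpow_of_ne_zero hzne]
    simp only [Complex.ofReal_re, Complex.ofReal_im, mul_zero, Real.exp_zero, div_one]
    calc ‖Complex.exp (-z * t)‖ * ‖z‖ ^ (β - 1) ≤ 1 * (5 / 2 * r) ^ (β - 1) := by
          gcongr
      _ = (5 / 2 : ℝ) ^ (β - 1) * r ^ (β - 1) := by
          rw [one_mul, Real.mul_rpow (by norm_num) hr.le]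
      _ ≤ (5 / 2 : ℝ) ^ (1 : ℝ) * r ^ (β - 1) := by
          gcongr
          · norm_num
          · linarith
      _ = _ := by rw [Real.rpow_one]
  obtain ⟨p, hp, hpe⟩ := exists_polynomial_approx hr hdiff hbound n
  have hfre : ∀ s : ℝ, 0 ≤ s → (f s).re = Real.exp (-s * t) * s ^ (β - 1) := fun s hs => by
    simp only [hf]
    rw [← Complex.ofReal_cpow hs, ← Complex.ofReal_neg, ← Complex.ofReal_mul, ← Complex.ofReal_exp,
      ← Complex.ofReal_mul, Complex.ofReal_re]
  have hcont : Continuous fun s : ℝ => Real.exp (-s * t) * s ^ (β - 1) :=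
    continuous_exp_mul_rpow hβ t
  have h := abs_integral_sub_gauss_le (ω := fun _ => (1 : ℝ)) continuous_const
    (by linarith : r < 2 * r) (fun _ _ => one_pos) hn hcont hp (fun s hs => by
      rw [← hfre s (hr.le.trans hs.1)]
      refine hpe s ?_
      rw [abs_le]
      constructor <;> linarith [hs.1, hs.2])
  simp only [one_mul, intervalIntegral.integral_const, smul_eq_mul, mul_one] at h
  refine h.trans (le_of_eq ?_)
  have : r ^ β = r ^ (β - 1) * r := by
    rw [← Real.rpow_add_one hr.ne', sub_add_cancel]
  rw [this]
  ring

/-- The Gauss-Jacobi error on an interval `[0, a]` with `a ≤ 1` and `a t ≤ 2`. -/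
theorem gaussJacobi_error {β t a : ℝ} (hβ : 1 < β) (ht : 0 ≤ t) (ha : 0 < a) (ha1 : a ≤ 1)
    (hat : a * t ≤ 2) {n : ℕ} (hn : 0 < n) :
    |(∫ s in (0 : ℝ)..a, Real.exp (-s * t) * s ^ (β - 1))
      - gaussJacobi β a n (fun s => Real.exp (-s * t))| ≤ 12 * (1 / 2) ^ n := by
  -- On the disc of radius a about this centre the real part is at least -a/2, so a t ≤ 2 bounds the
  -- exponential by e < 3.
  set c : ℝ := a / 2 with hc
  set f : ℂ → ℂ := fun z => Complex.exp (-z * t) with hf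
  have hbound : ∀ z ∈ Metric.closedBall (c : ℂ) a, ‖f z‖ ≤ 3 := fun z hz => by
    have h1 : |(z - c).re| ≤ a := (Complex.abs_re_le_norm _).trans (by rwa [← dist_eq_norm])
    rw [Complex.sub_re, Complex.ofReal_re, abs_le] at h1
    have h2 : -(z.re) * t ≤ 1 := by nlinarith [h1.1]
    rw [hf, Complex.norm_exp]
    simp only [Complex.mul_re, Complex.neg_re, Complex.ofReal_re, Complex.neg_im,
      Complex.ofReal_im, mul_zero, sub_zero]
    exact (Real.exp_le_exp.2 h2).trans (by linarith [Real.exp_one_lt_d9])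
  obtain ⟨p, hp, hpe⟩ := exists_polynomial_approx ha
    (by fun_prop : Differentiable ℂ f).differentiableOn hbound n
  have hfre : ∀ s : ℝ, (f s).re = Real.exp (-s * t) := fun s => by
    simp only [hf]
    rw [← Complex.ofReal_neg, ← Complex.ofReal_mul, ← Complex.ofReal_exp, Complex.ofReal_re]
  have hω : Continuous fun s : ℝ => s ^ (β - 1) := Real.continuous_rpow_const (by linarith)
  have h := abs_integral_sub_gauss_le (ω := fun s : ℝ => s ^ (β - 1)) hω ha
    (fun s hs => Real.rpow_pos_of_pos hs.1 _) hn
    (by fun_prop : Continuous fun s : ℝ => Real.exp (-s * t)) hp (fun s hs => by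
      rw [← hfre s]
      refine hpe s ?_
      rw [abs_le]
      constructor <;> linarith [hs.1, hs.2])
  have hmass : ∫ s in (0 : ℝ)..a, s ^ (β - 1) ≤ 1 := by
    have := intervalIntegral.integral_mono_on (μ := MeasureTheory.volume) ha.le
      (hω.intervalIntegrable 0 a) (continuous_const.intervalIntegrable 0 a)
      (fun s hs => Real.rpow_le_one hs.1 (hs.2.trans ha1) (by linarith : 0 ≤ β - 1))
    refine this.trans ?_
    simpa using ha1
  simp only [mul_comm (_ ^ (β - 1)) (Real.exp _)] at h
  refine h.trans ?_
  have : 2 * (2 * 3 * (1 / 2 : ℝ) ^ n) * ∫ s in (0 : ℝ)..a, s ^ (β - 1)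
      ≤ 2 * (2 * 3 * (1 / 2 : ℝ) ^ n) * 1 := by gcongr
  linarith

/-- The truncation error. -/
theorem abs_integral_Ioi_le {β t δ A : ℝ} (hβ : 1 < β) (hβ' : β < 2) (hδ : 0 < δ) (hδt : δ ≤ t)
    (hA : 1 ≤ A) :
    |∫ s in Set.Ioi A, Real.exp (-s * t) * s ^ (β - 1)|
      ≤ 4 / δ ^ 2 * Real.exp (-(A * δ / 2)) := by
  have hneg : -(δ / 2) < 0 := by linarith
  have hg : MeasureTheory.IntegrableOn (fun s : ℝ => 2 / δ * Real.exp (-(δ / 2) * s)) (Set.Ioi A) :=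
    (integrableOn_exp_mul_Ioi hneg A).const_mul _
  have hle := MeasureTheory.norm_integral_le_of_norm_le (f := fun s : ℝ => Real.exp (-s * t) * s ^ (β - 1)) hg (by
    filter_upwards [MeasureTheory.ae_restrict_mem measurableSet_Ioi] with s hs
    have hs1 : 1 ≤ s := hA.trans (le_of_lt hs)
    have hs0 : 0 < s := by linarith
    rw [Real.norm_eq_abs, abs_of_pos (by positivity)]
    have h1 : s ^ (β - 1) ≤ s := by
      conv_rhs => rw [← Real.rpow_one s]
      exact Real.rpow_le_rpow_of_exponent_le hs1 (by linarith)
    -- Half of the exponential decay is spent on the polynomial factor.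
    have h2 : s ≤ 2 / δ * Real.exp (δ / 2 * s) := by
      have := Real.add_one_le_exp (δ / 2 * s)
      have h3 : 2 / δ * (δ / 2 * s) = s := by field_simp
      calc s = 2 / δ * (δ / 2 * s) := h3.symm
        _ ≤ _ := by gcongr; linarith
    calc Real.exp (-s * t) * s ^ (β - 1)
        ≤ Real.exp (-s * δ) * (2 / δ * Real.exp (δ / 2 * s)) := by
          refine mul_le_mul (Real.exp_le_exp.2 (by nlinarith)) (h1.trans h2) (by positivity)
            (by positivity)
      _ = 2 / δ * Real.exp (-(δ / 2) * s) := by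
          rw [mul_left_comm, ← Real.exp_add]; ring_nf)
  rw [Real.norm_eq_abs] at hle
  refine hle.trans (le_of_eq ?_)
  rw [MeasureTheory.integral_const_mul, integral_exp_mul_Ioi hneg]
  have : -(δ / 2) * A = -(A * δ / 2) := by ring
  rw [this]
  field_simp
  ring

end LocalErrors


/-! ### Dyadic decomposition and total error -/

section CombinedRule

theorem sum_Icc_neg_eq_sum_range (F : ℤ → ℝ) (m : ℕ) :
    ∑ j ∈ Finset.Icc (-(m : ℤ)) (-1), F j = ∑ i ∈ Finset.range m, F (-((i : ℤ) + 1)) := by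
  induction m with
  | zero => simp
  | succ m ih =>
    have : Finset.Icc (-((m + 1 : ℕ) : ℤ)) (-1)
        = insert (-((m : ℤ) + 1)) (Finset.Icc (-(m : ℤ)) (-1)) := by
      ext j
      simp only [Finset.mem_Icc, Finset.mem_insert]
      push_cast
      omega
    rw [this, Finset.sum_insert (by simp), ih, Finset.sum_range_succ, add_comm]

theorem Gamma_div_rpow_eq_dyadic {β t : ℝ} (hβ : 1 < β) (ht : 0 < t) (m N : ℕ) :
    Real.Gamma β / t ^ β
      = (∫ s in (0 : ℝ)..(2 : ℝ) ^ (-(m : ℤ)), Real.exp (-s * t) * s ^ (β - 1))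
        + ∑ i ∈ Finset.range m, (∫ s in (2 : ℝ) ^ (-((i : ℤ) + 1))..(2 : ℝ) ^ (-(i : ℤ)),
            Real.exp (-s * t) * s ^ (β - 1))
        + ∑ j ∈ Finset.range (N + 1), (∫ s in (2 : ℝ) ^ j..(2 : ℝ) ^ (j + 1),
            Real.exp (-s * t) * s ^ (β - 1))
        + ∫ s in Set.Ioi ((2 : ℝ) ^ (N + 1)), Real.exp (-s * t) * s ^ (β - 1) := by
  set f : ℝ → ℝ := fun s => Real.exp (-s * t) * s ^ (β - 1) with hf
  have hcont : Continuous f := continuous_exp_mul_rpow hβ t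
  have hii : ∀ a b : ℝ, IntervalIntegrable f MeasureTheory.volume a b := fun a b =>
    hcont.intervalIntegrable a b
  have hint : MeasureTheory.IntegrableOn f (Set.Ioi 0) := by
    have := integrableOn_rpow_mul_exp_neg_mul_rpow (s := β - 1) (p := 1) (b := t) (by linarith)
      one_pos ht
    refine this.congr_fun (fun s _ => ?_) measurableSet_Ioi
    simp only [hf, Real.rpow_one]
    rw [mul_comm, neg_mul, neg_mul, mul_comm t s]
  have htotal : ∫ s in Set.Ioi (0 : ℝ), f s = Real.Gamma β / t ^ β := by
    have := Real.integral_rpow_mul_exp_neg_mul_Ioi (a := β) (r := t) (by linarith) ht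
    rw [Real.div_rpow zero_le_one ht.le, Real.one_rpow] at this
    rw [div_eq_mul_one_div, mul_comm, ← this]
    refine MeasureTheory.setIntegral_congr_fun measurableSet_Ioi fun s _ => ?_
    simp only [hf]
    rw [mul_comm, neg_mul, mul_comm t s]
  have hA : (0 : ℝ) ≤ 2 ^ (N + 1) := by positivity
  have h1 : ∫ s in Set.Ioi (0 : ℝ), f s
      = (∫ s in (0 : ℝ)..2 ^ (N + 1), f s) + ∫ s in Set.Ioi ((2 : ℝ) ^ (N + 1)), f s :=
    (intervalIntegral.integral_interval_add_Ioi hint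
      (hint.mono_set (Set.Ioi_subset_Ioi hA))).symm
  have h2 : ∑ j ∈ Finset.range (N + 1), (∫ s in (2 : ℝ) ^ j..(2 : ℝ) ^ (j + 1), f s)
      = ∫ s in (1 : ℝ)..2 ^ (N + 1), f s := by
    have := intervalIntegral.sum_integral_adjacent_intervals (f := f)
      (μ := MeasureTheory.volume) (a := fun j : ℕ => (2 : ℝ) ^ j) (n := N + 1) fun k _ => hii _ _
    simpa using this
  have h3 : ∑ i ∈ Finset.range m, (∫ s in (2 : ℝ) ^ (-((i : ℤ) + 1))..(2 : ℝ) ^ (-(i : ℤ)), f s)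
      = ∫ s in (2 : ℝ) ^ (-(m : ℤ))..1, f s := by
    have := intervalIntegral.sum_integral_adjacent_intervals (f := f)
      (μ := MeasureTheory.volume) (a := fun j : ℕ => (2 : ℝ) ^ (-(j : ℤ))) (n := m)
      fun k _ => hii _ _
    -- The telescoping sum runs downwards from 1, so every integral is reversed.
    rw [intervalIntegral.integral_symm, ← neg_inj, neg_neg, ← Finset.sum_neg_distrib]
    simp only [← intervalIntegral.integral_symm]
    simpa using this
  rw [← htotal, h1, h2, h3, intervalIntegral.integral_add_adjacent_intervals (hii _ _) (hii _ _),
    intervalIntegral.integral_add_adjacent_intervals (hii _ _) (hii _ _)]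

/-- Makes the errors below 1 a geometric series, with a bound free of the number of intervals. -/
theorem rpow_two_zpow_le {β : ℝ} (hβ : 1 < β) (i : ℕ) :
    ((2 : ℝ) ^ (-((i : ℤ) + 1))) ^ β ≤ 1 / 2 * (1 / 2) ^ i := by
  have h0 : (0 : ℝ) < (2 : ℝ) ^ (-((i : ℤ) + 1)) := by positivity
  have h1 : (2 : ℝ) ^ (-((i : ℤ) + 1)) = 1 / 2 * (1 / 2) ^ i := by
    rw [zpow_neg, zpow_add_one₀ two_ne_zero, zpow_natCast, one_div, mul_inv, inv_pow, mul_comm]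
  have h2 : (2 : ℝ) ^ (-((i : ℤ) + 1)) ≤ 1 := by
    rw [h1]
    have : ((1 : ℝ) / 2) ^ i ≤ 1 := pow_le_one₀ (by norm_num) (by norm_num)
    linarith
  calc ((2 : ℝ) ^ (-((i : ℤ) + 1))) ^ β ≤ ((2 : ℝ) ^ (-((i : ℤ) + 1))) ^ (1 : ℝ) :=
        Real.rpow_le_rpow_of_exponent_ge h0 h2 hβ.le
    _ = _ := by rw [Real.rpow_one, h1]

theorem rpow_two_pow_le {β : ℝ} (hβ : β < 2) (j : ℕ) : ((2 : ℝ) ^ j) ^ β ≤ 4 ^ j := by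
  calc ((2 : ℝ) ^ j) ^ β ≤ ((2 : ℝ) ^ j) ^ (2 : ℝ) :=
        Real.rpow_le_rpow_of_exponent_le (one_le_pow₀ one_le_two) hβ.le
    _ = 4 ^ j := by
        rw [Real.rpow_two, ← pow_mul, mul_comm, pow_mul]; norm_num

/-- The error of the combined rule, with the four sources of error kept apart. -/
theorem combinedRule_error {β t δ : ℝ} (hβ : 1 < β) (hβ' : β < 2) (hδ : 0 < δ) (hδt : δ ≤ t)
    {m nO nS N nL : ℕ} (hm : (2 : ℝ) ^ (-(m : ℤ)) * t ≤ 2) (hO : 0 < nO) (hS : 0 < nS)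
    (hL : 0 < nL) :
    |Real.Gamma β / t ^ β - combinedRule β nO (-(m : ℤ)) nS N nL t|
      ≤ 12 * (1 / 2) ^ nO + 10 * (1 / 2) ^ nS + 14 * 4 ^ N * (1 / 2) ^ nL
        + 4 / δ ^ 2 * Real.exp (-(2 ^ N * δ)) := by
  have ht : 0 < t := hδ.trans_le hδt
  rw [Gamma_div_rpow_eq_dyadic hβ ht m N, combinedRule, sum_Icc_neg_eq_sum_range]
  have ha1 : (2 : ℝ) ^ (-(m : ℤ)) ≤ 1 := zpow_le_one_of_nonpos₀ one_le_two (by omega)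
  have e1 := gaussJacobi_error hβ ht.le (by positivity) ha1 hm hO
  have e4 := abs_integral_Ioi_le hβ hβ' hδ hδt (A := 2 ^ (N + 1)) (one_le_pow₀ one_le_two)
  have hexp : (2 : ℝ) ^ (N + 1) * δ / 2 = 2 ^ N * δ := by ring
  rw [hexp] at e4
  have e2 : |(∑ i ∈ Finset.range m, (∫ s in (2 : ℝ) ^ (-((i : ℤ) + 1))..(2 : ℝ) ^ (-(i : ℤ)),
            Real.exp (-s * t) * s ^ (β - 1)))
        - ∑ i ∈ Finset.range m, gaussLegendre ((2 : ℝ) ^ (-((i : ℤ) + 1)))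
            ((2 : ℝ) ^ (-((i : ℤ) + 1) + 1)) nS (fun s => Real.exp (-s * t) * s ^ (β - 1))|
      ≤ 10 * (1 / 2) ^ nS := by
    rw [← Finset.sum_sub_distrib]
    refine (Finset.abs_sum_le_sum_abs _ _).trans ?_
    calc _ ≤ ∑ i ∈ Finset.range m, 5 * (1 / 2 : ℝ) ^ nS * (1 / 2) ^ i := by
          refine Finset.sum_le_sum fun i _ => ?_
          have hr : (0 : ℝ) < (2 : ℝ) ^ (-((i : ℤ) + 1)) := by positivity
          have h := gaussLegendre_error hβ hβ' ht.le hr hS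
          have h2 : 2 * (2 : ℝ) ^ (-((i : ℤ) + 1)) = 2 ^ (-(i : ℤ)) := by
            rw [← zpow_one_add₀ two_ne_zero]; congr 1; ring
          have h3 : -((i : ℤ) + 1) + 1 = -(i : ℤ) := by ring
          rw [h2] at h
          rw [h3]
          refine h.trans ?_
          have := mul_le_mul_of_nonneg_right (rpow_two_zpow_le hβ i)
            (by positivity : (0 : ℝ) ≤ (1 / 2) ^ nS)
          linarith
      _ = 5 * (1 / 2 : ℝ) ^ nS * ∑ i ∈ Finset.range m, (1 / 2 : ℝ) ^ i := by
          rw [Finset.mul_sum]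
      _ ≤ 5 * (1 / 2 : ℝ) ^ nS * 2 := by
          gcongr
          exact sum_geometric_two_le m
      _ = _ := by ring
  have e3 : |(∑ j ∈ Finset.range (N + 1), (∫ s in (2 : ℝ) ^ j..(2 : ℝ) ^ (j + 1),
            Real.exp (-s * t) * s ^ (β - 1)))
        - ∑ j ∈ Finset.range (N + 1), gaussLegendre ((2 : ℝ) ^ j) ((2 : ℝ) ^ (j + 1)) nL
            (fun s => Real.exp (-s * t) * s ^ (β - 1))|
      ≤ 14 * 4 ^ N * (1 / 2) ^ nL := by
    rw [← Finset.sum_sub_distrib]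
    refine (Finset.abs_sum_le_sum_abs _ _).trans ?_
    calc _ ≤ ∑ j ∈ Finset.range (N + 1), 10 * (1 / 2 : ℝ) ^ nL * 4 ^ j := by
          refine Finset.sum_le_sum fun j _ => ?_
          have hr : (0 : ℝ) < (2 : ℝ) ^ j := by positivity
          have h := gaussLegendre_error hβ hβ' ht.le hr hL
          rw [← pow_succ'] at h
          refine h.trans ?_
          have := mul_le_mul_of_nonneg_right (rpow_two_pow_le hβ' j)
            (by positivity : (0 : ℝ) ≤ (1 / 2) ^ nL)
          linarith
      _ = 10 * (1 / 2 : ℝ) ^ nL * ∑ j ∈ Finset.range (N + 1), (4 : ℝ) ^ j := by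
          rw [Finset.mul_sum]
      -- The geometric sum is below 4/3 times its last term, and 40/3 ≤ 14.
      _ ≤ 10 * (1 / 2 : ℝ) ^ nL * (4 / 3 * 4 ^ N) := by
          gcongr
          rw [geom_sum_eq (by norm_num), pow_succ]
          have : (0 : ℝ) < 4 ^ N := by positivity
          linarith
      _ ≤ _ := by
          have : (0 : ℝ) < (1 / 2 : ℝ) ^ nL * 4 ^ N := by positivity
          linarith
  simp only [abs_le] at *
  constructor <;> linarith [e1.1, e1.2, e2.1, e2.2, e3.1, e3.2, e4.1, e4.2]

end CombinedRule

/-! ### Positive sums of exponentials -/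

section SumsOfExponentials

/-- `F` is a sum of `n` decaying exponentials with positive rates and positive coefficients. -/
def IsPosExpSum (F : ℝ → ℝ) (n : ℕ) : Prop :=
  ∃ s w : Fin n → ℝ, (∀ i, 0 < s i) ∧ (∀ i, 0 < w i) ∧
    ∀ t, F t = ∑ i, w i * Real.exp (-s i * t)

theorem IsPosExpSum.zero : IsPosExpSum (fun _ => 0) 0 :=
  ⟨Fin.elim0, Fin.elim0, fun i => i.elim0, fun i => i.elim0, by simp⟩

theorem IsPosExpSum.single {s w : ℝ} (hs : 0 < s) (hw : 0 < w) :
    IsPosExpSum (fun t => w * Real.exp (-s * t)) 1 :=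
  ⟨fun _ => s, fun _ => w, fun _ => hs, fun _ => hw, by simp⟩

theorem IsPosExpSum.add {F G : ℝ → ℝ} {m n : ℕ} (hF : IsPosExpSum F m) (hG : IsPosExpSum G n) :
    IsPosExpSum (fun t => F t + G t) (m + n) := by
  obtain ⟨s, w, hs, hw, hF⟩ := hF
  obtain ⟨s', w', hs', hw', hG⟩ := hG
  refine ⟨Fin.append s s', Fin.append w w', fun i => ?_, fun i => ?_, fun t => ?_⟩
  · refine Fin.addCases (fun i => ?_) (fun i => ?_) i <;> simp [hs, hs']
  · refine Fin.addCases (fun i => ?_) (fun i => ?_) i <;> simp [hw, hw']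
  · simp only [hF, hG]
    rw [Fin.sum_univ_add]
    simp

theorem IsPosExpSum.const_mul {F : ℝ → ℝ} {n : ℕ} (hF : IsPosExpSum F n) {c : ℝ} (hc : 0 < c) :
    IsPosExpSum (fun t => c * F t) n := by
  obtain ⟨s, w, hs, hw, hF⟩ := hF
  refine ⟨s, fun i => c * w i, hs, fun i => mul_pos hc (hw i), fun t => ?_⟩
  simp only [hF, Finset.mul_sum, mul_assoc]

theorem IsPosExpSum.sum {ι : Type*} (S : Finset ι) {F : ι → ℝ → ℝ} {n : ℕ}
    (h : ∀ i ∈ S, IsPosExpSum (F i) n) :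
    IsPosExpSum (fun t => ∑ i ∈ S, F i t) (S.card * n) := by
  classical
  induction S using Finset.induction_on with
  | empty => simpa using IsPosExpSum.zero
  | insert a S ha ih =>
    have := (h a (Finset.mem_insert_self a S)).add
      (ih fun i hi => h i (Finset.mem_insert_of_mem hi))
    simp only [Finset.sum_insert ha, Finset.card_insert_of_notMem ha]
    rwa [add_mul, one_mul, add_comm]

theorem isPosExpSum_gaussJacobi {β a : ℝ} (hβ : 1 < β) (ha : 0 < a) (n : ℕ) :
    IsPosExpSum (fun t => gaussJacobi β a n fun s => Real.exp (-s * t)) n := by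
  have hω : Continuous fun s : ℝ => s ^ (β - 1) := Real.continuous_rpow_const (by linarith)
  have hpos : ∀ s ∈ Set.Ioo 0 a, 0 < s ^ (β - 1) := fun s hs => Real.rpow_pos_of_pos hs.1 _
  obtain ⟨hcard, hmem⟩ := gaussNodes_card_and_mem hω ha hpos n
  have := IsPosExpSum.sum (gaussNodes (fun s => s ^ (β - 1)) 0 a n) fun x hx =>
    IsPosExpSum.single (hmem x hx).1 (gaussWeight_pos hω ha hpos n hx)
  rw [hcard, mul_one] at this
  simpa only [gaussJacobi, mul_comm (gaussWeight _ _ _ _ _)] using this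

theorem isPosExpSum_gaussLegendre {a b : ℝ} (β : ℝ) (ha : 0 < a) (hab : a < b) (n : ℕ) :
    IsPosExpSum (fun t => gaussLegendre a b n fun s => Real.exp (-s * t) * s ^ (β - 1)) n := by
  have hω : Continuous fun _ : ℝ => (1 : ℝ) := continuous_const
  have hpos : ∀ s ∈ Set.Ioo a b, (0 : ℝ) < 1 := fun _ _ => one_pos
  obtain ⟨hcard, hmem⟩ := gaussNodes_card_and_mem hω hab hpos n
  have := IsPosExpSum.sum (gaussNodes (fun _ => (1 : ℝ)) a b n) fun x hx =>
    IsPosExpSum.single (ha.trans (hmem x hx).1)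
      (mul_pos (gaussWeight_pos hω hab hpos n hx)
        (Real.rpow_pos_of_pos (ha.trans (hmem x hx).1) (β - 1)))
  rw [hcard, mul_one] at this
  simp only [gaussLegendre]
  have hcomm : ∀ t x : ℝ, Real.exp (-x * t) * x ^ (β - 1) * gaussWeight (fun _ => 1) a b n x
      = gaussWeight (fun _ => 1) a b n x * x ^ (β - 1) * Real.exp (-x * t) := fun t x => by ring
  simpa only [hcomm] using this

theorem isPosExpSum_combinedRule {β : ℝ} (hβ : 1 < β) (nO : ℕ) {M : ℤ} (hM : M ≤ 0)
    (nS N nL : ℕ) :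
    IsPosExpSum (combinedRule β nO M nS N nL) (numExp nO M nS N nL) := by
  have h1 := isPosExpSum_gaussJacobi hβ (by positivity : (0 : ℝ) < 2 ^ M) nO
  have h2 := IsPosExpSum.sum (Finset.Icc M (-1)) fun j _ =>
    isPosExpSum_gaussLegendre β (by positivity : (0 : ℝ) < 2 ^ j)
      (zpow_lt_zpow_right₀ one_lt_two (lt_add_one j)) nS
  have h3 := IsPosExpSum.sum (Finset.range (N + 1)) fun j _ =>
    isPosExpSum_gaussLegendre β (by positivity : (0 : ℝ) < 2 ^ j)
      (pow_lt_pow_right₀ one_lt_two (lt_add_one j)) nL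
  -- Here M ≤ 0 matters: for positive M the index set is empty.
  have hc : (Finset.Icc M (-1)).card = M.natAbs := by
    rw [Int.card_Icc]; omega
  rw [hc] at h2
  rw [Finset.card_range] at h3
  exact (h1.add h2).add h3

end SumsOfExponentials


/-! ### Choice of parameters and counting -/

section Parameters

/-- The number of quadrature points on the intervals below `1`. -/
noncomputable def smallPoints (ε : ℝ) : ℕ := ⌈Real.log (1 / ε) / Real.log 2⌉₊ + 6

/-- The number of dyadic intervals between `1 / T` and `1`. -/
noncomputable def dyadicDepth (T : ℝ) : ℕ := ⌊Real.log T / Real.log 2⌋₊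

/-- The exponent at which the integral over `[1, ∞)` is truncated. -/
noncomputable def truncExponent (ε δ : ℝ) : ℕ :=
  ⌈(Real.log 16 + Real.log (Real.log (1 / ε)) + 2 * Real.log (1 / δ)) / Real.log 2⌉₊

/-- The number of quadrature points on the intervals above `1`. -/
noncomputable def largePoints (ε δ : ℝ) : ℕ := 2 * truncExponent ε δ + smallPoints ε

theorem exp_le_two_pow_of_div_log_two_le {x : ℝ} {n : ℕ} (h : x / Real.log 2 ≤ n) :
    Real.exp x ≤ 2 ^ n := by
  rw [div_le_iff₀ (Real.log_pos one_lt_two), ← Real.log_pow] at h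
  exact (Real.le_log_iff_exp_le (by positivity) ).1 h

theorem half_pow_smallPoints_le {ε : ℝ} (hε : 0 < ε) :
    (1 / 2 : ℝ) ^ smallPoints ε ≤ ε / 64 := by
  have h := exp_le_two_pow_of_div_log_two_le (Nat.le_ceil (Real.log (1 / ε) / Real.log 2))
  rw [Real.exp_log (by positivity)] at h
  have h2 : (64 : ℝ) / ε ≤ 2 ^ smallPoints ε := by
    rw [smallPoints, pow_add]
    calc (64 : ℝ) / ε = 1 / ε * 2 ^ 6 := by ring
      _ ≤ _ := by gcongr
  rw [one_div, inv_pow]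
  calc ((2 : ℝ) ^ smallPoints ε)⁻¹ ≤ (64 / ε)⁻¹ := by gcongr
    _ = ε / 64 := inv_div _ _

/-- Rounding down loses a factor of 2, hence the bound 2. Rounding up would break |M| ≤ C log T for
T slightly above 1. -/
theorem zpow_neg_dyadicDepth_mul_le {t T : ℝ} (ht : 0 < t) (htT : t ≤ T) :
    (2 : ℝ) ^ (-(dyadicDepth T : ℤ)) * t ≤ 2 := by
  have h := (Nat.lt_floor_add_one (Real.log T / Real.log 2)).le
  have h1 : Real.exp (Real.log T) ≤ 2 ^ (dyadicDepth T + 1) :=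
    exp_le_two_pow_of_div_log_two_le (by push_cast; exact h)
  rw [Real.exp_log (ht.trans_le htT), pow_succ] at h1
  rw [zpow_neg, zpow_natCast, inv_mul_le_iff₀ (by positivity)]
  exact htT.trans h1

theorem truncation_le {ε δ : ℝ} (hε : 0 < ε) (hL : 1 ≤ Real.log (1 / ε)) (hδ : 0 < δ)
    (hδ1 : δ ≤ 1) : 4 / δ ^ 2 * Real.exp (-(2 ^ truncExponent ε δ * δ)) ≤ ε / 4 := by
  set L := Real.log (1 / ε) with hLdef
  set D := Real.log (1 / δ) with hDdef
  have hD : 0 ≤ D := Real.log_nonneg (by rw [le_div_iff₀ hδ]; linarith)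
  have hexpD : Real.exp D = 1 / δ := Real.exp_log (by positivity)
  have hexpL : Real.exp L = 1 / ε := Real.exp_log (by positivity)
  have h : Real.exp (Real.log 16 + Real.log L + 2 * D) ≤ 2 ^ truncExponent ε δ :=
    exp_le_two_pow_of_div_log_two_le (Nat.le_ceil _)
  rw [Real.exp_add, Real.exp_add, Real.exp_log (by norm_num), Real.exp_log (by linarith),
    two_mul, Real.exp_add, hexpD] at h
  -- The truncation exponent gives 2^N ≥ 16 L / δ²; one factor 1/δ is lost to δ, and the other
  -- dominates 1 + D.
  have h1 : 16 * L * (1 / δ) ≤ 2 ^ truncExponent ε δ * δ := by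
    calc 16 * L * (1 / δ) = 16 * L * (1 / δ * (1 / δ)) * δ := by field_simp
      _ ≤ _ := by
        gcongr
  have h2 : 1 + D ≤ 1 / δ := by
    rw [← hexpD]; linarith [Real.add_one_le_exp D]
  have h3 : 16 * L * (1 + D) ≤ 16 * L * (1 / δ) := by gcongr
  have hlog : Real.log 16 ≤ 3 := by
    have : (16 : ℝ) = 2 ^ 4 := by norm_num
    rw [this, Real.log_pow]
    have := Real.log_two_lt_d9
    push_cast
    linarith
  have h4 : Real.log 16 + (D + D) + L ≤ 2 ^ truncExponent ε δ * δ := by nlinarith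
  calc 4 / δ ^ 2 * Real.exp (-(2 ^ truncExponent ε δ * δ))
      ≤ 4 / δ ^ 2 * Real.exp (-(Real.log 16 + (D + D) + L)) := by gcongr
    _ = ε / 4 := by
      rw [Real.exp_neg, Real.exp_add, Real.exp_add, Real.exp_add, hexpD, hexpL,
        Real.exp_log (by norm_num)]
      field_simp
      norm_num

theorem combinedRule_error_le {ε δ T β t : ℝ} (hε : 0 < ε) (hL : 1 ≤ Real.log (1 / ε))
    (hδ : 0 < δ) (hδ1 : δ ≤ 1) (hβ : 1 < β) (hβ' : β < 2) (hδt : δ ≤ t) (htT : t ≤ T) :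
    |Real.Gamma β / t ^ β - combinedRule β (smallPoints ε) (-(dyadicDepth T : ℤ))
      (smallPoints ε) (truncExponent ε δ) (largePoints ε δ) t| ≤ ε := by
  have hpos : 0 < smallPoints ε := by unfold smallPoints; omega
  have h := combinedRule_error (nO := smallPoints ε) (nS := smallPoints ε)
    (N := truncExponent ε δ) (nL := largePoints ε δ) hβ hβ' hδ hδt
    (zpow_neg_dyadicDepth_mul_le (hδ.trans_le hδt) htT) hpos hpos
    (by unfold largePoints; omega)
  have h1 := half_pow_smallPoints_le hε
  have h2 := truncation_le hε hL hδ hδ1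
  have h3 : (14 : ℝ) * 4 ^ truncExponent ε δ * (1 / 2) ^ largePoints ε δ
      = 14 * (1 / 2) ^ smallPoints ε := by
    have : ((1 : ℝ) / 2) ^ (2 * truncExponent ε δ) = (4 ^ truncExponent ε δ)⁻¹ := by
      rw [pow_mul, ← inv_pow]; norm_num
    rw [largePoints, pow_add, this]
    field_simp
  rw [h3] at h
  -- The error budget is (12 + 10 + 14) ε/64 + ε/4 ≤ ε.
  linarith

theorem log_two_bounds : 1 / 2 < Real.log 2 ∧ Real.log 2 < 1 :=
  ⟨by linarith [Real.log_two_gt_d9], by linarith [Real.log_two_lt_d9]⟩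

theorem div_log_two_le {x : ℝ} (hx : 0 ≤ x) : x / Real.log 2 ≤ 2 * x := by
  rw [div_le_iff₀ (Real.log_pos one_lt_two)]
  nlinarith [log_two_bounds.1]

theorem smallPoints_le {ε : ℝ} (hL : 1 ≤ Real.log (1 / ε)) :
    (smallPoints ε : ℝ) ≤ 9 * Real.log (1 / ε) := by
  have h := Nat.ceil_lt_add_one (div_nonneg (zero_le_one.trans hL) (Real.log_nonneg one_le_two))
  have h1 := div_log_two_le (zero_le_one.trans hL)
  rw [smallPoints]
  push_cast
  linarith

theorem dyadicDepth_le {T : ℝ} (hT : 1 ≤ T) : (dyadicDepth T : ℝ) ≤ 2 * Real.log T :=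
  (Nat.floor_le (div_nonneg (Real.log_nonneg hT) (Real.log_nonneg one_le_two))).trans
    (div_log_two_le (Real.log_nonneg hT))

/-- The additive constant is 6: 4 from log 16 / log 2, 1 from the ceiling and 1 from counting N + 1
intervals. It is absorbed through log log(1/ε) ≥ c. -/
theorem truncExponent_add_one_le {ε δ c : ℝ} (hc : 0 < c) (hLL : c ≤ Real.log (Real.log (1 / ε)))
    (hD : 0 ≤ Real.log (1 / δ)) :
    (truncExponent ε δ : ℝ) + 1
      ≤ (8 / c + 4) * (Real.log (Real.log (1 / ε)) + Real.log (1 / δ)) := by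
  set LL := Real.log (Real.log (1 / ε))
  set D := Real.log (1 / δ)
  have h16 : Real.log 16 = 4 * Real.log 2 := by
    rw [show (16 : ℝ) = 2 ^ 4 by norm_num, Real.log_pow]; norm_num
  have hl : Real.log 2 ≠ 0 := (Real.log_pos one_lt_two).ne'
  have hnn : 0 ≤ (Real.log 16 + LL + 2 * D) / Real.log 2 :=
    div_nonneg (by linarith [Real.log_nonneg (by norm_num : (1 : ℝ) ≤ 16)])
      (Real.log_nonneg one_le_two)
  have h := Nat.ceil_lt_add_one hnn
  have h1 : (Real.log 16 + LL + 2 * D) / Real.log 2 = 4 + (LL + 2 * D) / Real.log 2 := by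
    rw [h16]; field_simp
    ring
  have h2 := div_log_two_le (by linarith : 0 ≤ LL + 2 * D)
  have h3 : 8 ≤ 8 / c * (LL + D) := by
    rw [div_mul_eq_mul_div, le_div_iff₀ hc]
    linarith
  rw [truncExponent]
  linarith

theorem numExp_le {ε δ T c : ℝ} (hc : 0 < c) (hL : 1 ≤ Real.log (1 / ε))
    (hLL : c ≤ Real.log (Real.log (1 / ε))) (hδ : 0 < δ) (hδ1 : δ ≤ 1) (hT : 1 ≤ T) :
    (numExp (smallPoints ε) (-(dyadicDepth T : ℤ)) (smallPoints ε) (truncExponent ε δ)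
        (largePoints ε δ) : ℝ)
      ≤ (9 / c + 18 + (8 / c + 4) * (2 * (8 / c + 4) + 9)) * expRate ε δ T := by
  have hD : 0 ≤ Real.log (1 / δ) := Real.log_nonneg (by rw [le_div_iff₀ hδ]; linarith)
  have hτ : 0 ≤ Real.log T := Real.log_nonneg hT
  have hS := smallPoints_le hL
  have hM := dyadicDepth_le hT
  have hN := truncExponent_add_one_le hc hLL hD
  have hLLL : Real.log (Real.log (1 / ε)) ≤ Real.log (1 / ε) :=
    (Real.log_le_sub_one_of_pos (by linarith)).trans (by linarith)
  have hTδ : Real.log (T / δ) = Real.log T + Real.log (1 / δ) := by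
    rw [div_eq_mul_one_div, Real.log_mul (by positivity) (by positivity)]
  rw [numExp, expRate, hTδ, largePoints]
  simp only [Int.natAbs_neg, Int.natAbs_natCast]
  push_cast
  set L := Real.log (1 / ε)
  set LL := Real.log L
  set D := Real.log (1 / δ)
  set τ := Real.log T
  set A := 8 / c + 4 with hA
  have hA0 : 0 < A := by positivity
  have hnL : 2 * (truncExponent ε δ : ℝ) + smallPoints ε ≤ (2 * A + 9) * (L + D) := by
    have : A * (LL + D) ≤ A * (L + D) := by gcongr
    linarith
  have hLL0 : 0 < LL := hc.trans_le hLL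
  set R := L * (LL + (τ + D)) + D * (LL + D) with hR
  -- The rate has no isolated term L, so L is bounded through L · LL.
  have e1 : 9 * L ≤ 9 / c * R := by
    rw [div_mul_eq_mul_div, le_div_iff₀ hc]
    have : L * c ≤ L * LL := by gcongr
    have h2 : L * LL ≤ R := by
      have : 0 ≤ L * (τ + D) + D * (LL + D) := by positivity
      linarith
    linarith
  have e2 : (dyadicDepth T : ℝ) * smallPoints ε ≤ 18 * R := by
    calc (dyadicDepth T : ℝ) * smallPoints ε ≤ 2 * τ * (9 * L) := by gcongr
      _ = 18 * (L * τ) := by ring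
      _ ≤ 18 * R := by
        have : 0 ≤ L * (LL + D) + D * (LL + D) := by positivity
        linarith
  have e3 : ((truncExponent ε δ : ℝ) + 1) * (2 * truncExponent ε δ + smallPoints ε)
      ≤ A * (2 * A + 9) * R := by
    calc _ ≤ A * (LL + D) * ((2 * A + 9) * (L + D)) := by gcongr
      _ = A * (2 * A + 9) * ((LL + D) * (L + D)) := by ring
      -- In fact (LL + D)(L + D) = R - L τ.
      _ ≤ A * (2 * A + 9) * R := by
        gcongr
        have : 0 ≤ L * τ := by positivity
        linarith
  linarith

/-- Halving ε at most doubles log(1/ε), hence adds at most log 2 < 1 to its logarithm, which is at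
least c. Needed because (d) runs the rule at accuracy ε/2. -/
theorem expRate_half_le {ε δ T c : ℝ} (hε : 0 < ε) (hc : 0 < c) (hL : 1 ≤ Real.log (1 / ε))
    (hLL : c ≤ Real.log (Real.log (1 / ε))) (hδ : 0 < δ) (hδ1 : δ ≤ 1) (hT : 1 ≤ T) :
    expRate (ε / 2) δ T ≤ 2 * (1 + 1 / c) * expRate ε δ T := by
  have hD : 0 ≤ Real.log (1 / δ) := Real.log_nonneg (by rw [le_div_iff₀ hδ]; linarith)
  have hTD : 0 ≤ Real.log (T / δ) := Real.log_nonneg (by rw [le_div_iff₀ hδ]; linarith)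
  have hhalf : Real.log (1 / (ε / 2)) = Real.log (1 / ε) + Real.log 2 := by
    rw [← Real.log_mul (by positivity) two_ne_zero]
    congr 1
    field_simp
  have hl := log_two_bounds
  have h1 : Real.log (1 / (ε / 2)) ≤ 2 * Real.log (1 / ε) := by linarith
  have h2 : Real.log (Real.log (1 / (ε / 2)))
      ≤ (1 + 1 / c) * Real.log (Real.log (1 / ε)) := by
    have h3 := Real.log_le_log (by linarith) h1
    rw [Real.log_mul two_ne_zero (by linarith)] at h3
    have h4 : 1 ≤ 1 / c * Real.log (Real.log (1 / ε)) := by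
      rw [div_mul_eq_mul_div, le_div_iff₀ hc]
      linarith
    linarith
  have h0 : 0 ≤ Real.log (Real.log (1 / (ε / 2))) := Real.log_nonneg (by linarith)
  rw [expRate, expRate]
  set L := Real.log (1 / ε)
  set LL := Real.log L
  set D := Real.log (1 / δ)
  set B := Real.log (T / δ)
  have hLL0 : 0 < LL := hc.trans_le hLL
  set K := 1 + 1 / c with hK
  have hK1 : 1 ≤ K := by
    have : 0 < 1 / c := by positivity
    linarith
  have hKB : B ≤ K * B := le_mul_of_one_le_left hTD hK1
  have hKD : D ≤ K * D := le_mul_of_one_le_left hD hK1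
  calc _ ≤ 2 * L * (K * LL + K * B) + D * (K * LL + K * D) := by gcongr
    _ ≤ 2 * L * (K * LL + K * B) + 2 * (D * (K * LL + K * D)) := by
      have : 0 ≤ D * (K * LL + K * D) := by positivity
      linarith
    _ = _ := by ring

/-- From β Γ(β) = Γ(β + 1) ≥ Γ(2) = 1. -/
theorem half_le_Gamma {β : ℝ} (hβ : 1 < β) (hβ' : β < 2) : 1 / 2 ≤ Real.Gamma β := by
  have h1 : Real.Gamma 2 ≤ Real.Gamma (β + 1) :=
    Real.Gamma_strictMonoOn_Ici.monotoneOn (Set.mem_Ici.2 le_rfl)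
      (Set.mem_Ici.2 (by linarith)) (by linarith)
  rw [Real.Gamma_two, Real.Gamma_add_one (by linarith)] at h1
  nlinarith

end Parameters

end GaussSOE

/-! ### The main theorem -/

theorem theorem2p5 (ε₀ : ℝ) (hε₀ : 0 < ε₀) (hε₀' : ε₀ < Real.exp (-1)) :
    ∃ (C : ℝ) (nO nS : ℝ → ℕ) (M : ℝ → ℤ) (N nL : ℝ → ℝ → ℕ), 0 < C ∧
      -- orders of the parameters
      (∀ ε : ℝ, 0 < ε → ε ≤ ε₀ →
        (nO ε : ℝ) ≤ C * Real.log (1 / ε) ∧ (nS ε : ℝ) ≤ C * Real.log (1 / ε)) ∧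
      (∀ T : ℝ, 1 ≤ T → M T ≤ 0 ∧ |(M T : ℝ)| ≤ C * Real.log T) ∧
      (∀ ε δ : ℝ, 0 < ε → ε ≤ ε₀ → 0 < δ → δ ≤ 1 →
        (N ε δ : ℝ) ≤ C * (Real.log (Real.log (1 / ε)) + Real.log (1 / δ)) ∧
        (nL ε δ : ℝ) ≤ C * (Real.log (1 / ε) + Real.log (1 / δ))) ∧
      -- total number of exponentials, and the uniform error bound
      (∀ ε δ T : ℝ, 0 < ε → ε ≤ ε₀ → 0 < δ → δ ≤ 1 → 1 ≤ T →
        (GaussSOE.numExp (nO ε) (M T) (nS ε) (N ε δ) (nL ε δ) : ℝ)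
            ≤ C * GaussSOE.expRate ε δ T ∧
        ∀ β : ℝ, 1 < β → β < 2 → ∀ t : ℝ, δ ≤ t → t ≤ T →
          |Real.Gamma β / t ^ β
            - GaussSOE.combinedRule β (nO ε) (M T) (nS ε) (N ε δ) (nL ε δ) t| ≤ ε) ∧
      -- the resulting sum-of-exponentials approximation of `t ^ (-1 - α)`
      (∀ ε δ T : ℝ, 0 < ε → ε ≤ ε₀ → 0 < δ → δ ≤ 1 → 1 ≤ T →
        ∀ α : ℝ, 0 < α → α < 1 →
          ∃ (n : ℕ) (s w : Fin n → ℝ), (n : ℝ) ≤ C * GaussSOE.expRate ε δ T ∧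
            (∀ i, 0 < s i) ∧ (∀ i, 0 < w i) ∧
            ∀ t : ℝ, δ ≤ t → t ≤ T →
              |1 / t ^ (1 + α) - ∑ i, w i * Real.exp (-s i * t)| ≤ ε) := by
  have hL₀ : 1 < Real.log (1 / ε₀) := by
    rw [one_div, Real.log_inv, lt_neg]
    exact (Real.log_lt_iff_lt_exp hε₀).2 hε₀'
  set c := Real.log (Real.log (1 / ε₀)) with hcdef
  have hc : 0 < c := Real.log_pos hL₀
  have hlogs : ∀ ε : ℝ, 0 < ε → ε ≤ ε₀ →
      1 ≤ Real.log (1 / ε) ∧ c ≤ Real.log (Real.log (1 / ε)) := fun ε hε hle => by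
    have h : Real.log (1 / ε₀) ≤ Real.log (1 / ε) :=
      Real.log_le_log (by positivity) (by gcongr)
    exact ⟨hL₀.le.trans h, Real.log_le_log (by linarith) h⟩
  have hDnn : ∀ δ : ℝ, 0 < δ → δ ≤ 1 → 0 ≤ Real.log (1 / δ) := fun δ hδ hδ1 =>
    Real.log_nonneg (by rw [le_div_iff₀ hδ]; linarith)
  set A := 8 / c + 4 with hA
  have hA4 : 4 ≤ A := by
    have : 0 < 8 / c := by positivity
    linarith
  set C₁ := 9 / c + 18 + A * (2 * A + 9) with hC₁
  -- `C₁` comes from counting at accuracy ε; the factor `K` pays for replacing ε by ε/2 in (d).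
  set K := 2 * (1 + 1 / c) with hK
  have hK1 : 1 ≤ K := by
    have : 0 < 1 / c := by positivity
    linarith
  have h9c : 0 < 9 / c := by positivity
  have hC₁A : 2 * A + 9 ≤ C₁ := by nlinarith
  have hC₁0 : 0 < C₁ := by linarith
  have hCC : C₁ ≤ K * C₁ := le_mul_of_one_le_left hC₁0.le hK1
  have hnum : ∀ ε δ T : ℝ, 0 < ε → ε ≤ ε₀ → 0 < δ → δ ≤ 1 → 1 ≤ T →
      (GaussSOE.numExp (GaussSOE.smallPoints ε) (-(GaussSOE.dyadicDepth T : ℤ))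
        (GaussSOE.smallPoints ε) (GaussSOE.truncExponent ε δ) (GaussSOE.largePoints ε δ) : ℝ)
        ≤ C₁ * GaussSOE.expRate ε δ T := fun ε δ T hε hle hδ hδ1 hT =>
    GaussSOE.numExp_le hc (hlogs ε hε hle).1 (hlogs ε hε hle).2 hδ hδ1 hT
  have hrate : ∀ ε δ T : ℝ, 0 < ε → ε ≤ ε₀ → 0 < δ → δ ≤ 1 → 1 ≤ T →
      0 ≤ GaussSOE.expRate ε δ T := fun ε δ T hε hle hδ hδ1 hT =>
    nonneg_of_mul_nonneg_right ((Nat.cast_nonneg _).trans (hnum ε δ T hε hle hδ hδ1 hT)) hC₁0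
  refine ⟨K * C₁, GaussSOE.smallPoints, GaussSOE.smallPoints,
    fun T => -(GaussSOE.dyadicDepth T : ℤ), GaussSOE.truncExponent, GaussSOE.largePoints,
    by positivity, fun ε hε hle => ?_, fun T hT => ?_, fun ε δ hε hle hδ hδ1 => ?_,
    fun ε δ T hε hle hδ hδ1 hT => ⟨?_, fun β hβ hβ' t hδt htT => ?_⟩,
    fun ε δ T hε hle hδ hδ1 hT α hα hα' => ?_⟩
  · obtain ⟨hL, -⟩ := hlogs ε hε hle
    have h : (GaussSOE.smallPoints ε : ℝ) ≤ K * C₁ * Real.log (1 / ε) :=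
      (GaussSOE.smallPoints_le hL).trans
        (mul_le_mul_of_nonneg_right (by linarith) (zero_le_one.trans hL))
    exact ⟨h, h⟩
  · refine ⟨by simp, ?_⟩
    push_cast
    rw [abs_neg, Nat.abs_cast]
    exact (GaussSOE.dyadicDepth_le hT).trans
      (mul_le_mul_of_nonneg_right (by linarith) (Real.log_nonneg hT))
  · obtain ⟨hL, hLL⟩ := hlogs ε hε hle
    have hD := hDnn δ hδ hδ1
    have hN := GaussSOE.truncExponent_add_one_le hc hLL hD
    have hLLL : Real.log (Real.log (1 / ε)) ≤ Real.log (1 / ε) :=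
      (Real.log_le_sub_one_of_pos (by linarith)).trans (by linarith)
    constructor
    · refine (le_add_of_nonneg_right zero_le_one).trans (hN.trans ?_)
      exact mul_le_mul_of_nonneg_right (by linarith) (by linarith)
    · have hS := GaussSOE.smallPoints_le hL
      have h1 : A * (Real.log (Real.log (1 / ε)) + Real.log (1 / δ))
          ≤ A * (Real.log (1 / ε) + Real.log (1 / δ)) := by gcongr
      have h2 : (2 * A + 9) * (Real.log (1 / ε) + Real.log (1 / δ))
          ≤ K * C₁ * (Real.log (1 / ε) + Real.log (1 / δ)) :=
        mul_le_mul_of_nonneg_right (by linarith) (by linarith)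
      rw [GaussSOE.largePoints]
      push_cast
      linarith
  · exact (hnum ε δ T hε hle hδ hδ1 hT).trans
      (mul_le_mul_of_nonneg_right hCC (hrate ε δ T hε hle hδ hδ1 hT))
  · exact GaussSOE.combinedRule_error_le hε (hlogs ε hε hle).1 hδ hδ1 hβ hβ' hδt htT
  -- Dividing by Γ(1 + α) ≥ 1/2 at most doubles the error, so the rule is used at ε/2.
  · have hε2 : 0 < ε / 2 := by positivity
    have hle2 : ε / 2 ≤ ε₀ := by linarith
    obtain ⟨hL, hLL⟩ := hlogs ε hε hle
    have hβ : 1 < 1 + α := by linarith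
    have hβ' : 1 + α < 2 := by linarith
    have hΓ := GaussSOE.half_le_Gamma hβ hβ'
    have hΓ0 : 0 < Real.Gamma (1 + α) := by linarith
    obtain ⟨s, w, hs, hw, hsum⟩ := (GaussSOE.isPosExpSum_combinedRule hβ
      (GaussSOE.smallPoints (ε / 2)) (by simp : -(GaussSOE.dyadicDepth T : ℤ) ≤ 0)
      (GaussSOE.smallPoints (ε / 2)) (GaussSOE.truncExponent (ε / 2) δ)
      (GaussSOE.largePoints (ε / 2) δ)).const_mul (inv_pos.2 hΓ0)
    refine ⟨_, s, w, ?_, hs, hw, fun t hδt htT => ?_⟩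
    · refine (hnum (ε / 2) δ T hε2 hle2 hδ hδ1 hT).trans ?_
      rw [mul_comm K, mul_assoc]
      exact mul_le_mul_of_nonneg_left
        (GaussSOE.expRate_half_le hε hc hL hLL hδ hδ1 hT) hC₁0.le
    · have h := GaussSOE.combinedRule_error_le hε2 (hlogs _ hε2 hle2).1 hδ hδ1 hβ hβ' hδt htT
      rw [← hsum t]
      set Q := GaussSOE.combinedRule (1 + α) (GaussSOE.smallPoints (ε / 2))
        (-(GaussSOE.dyadicDepth T : ℤ)) (GaussSOE.smallPoints (ε / 2))
        (GaussSOE.truncExponent (ε / 2) δ) (GaussSOE.largePoints (ε / 2) δ) t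
      have heq : 1 / t ^ (1 + α) - (Real.Gamma (1 + α))⁻¹ * Q
          = (Real.Gamma (1 + α))⁻¹ * (Real.Gamma (1 + α) / t ^ (1 + α) - Q) := by
        rw [mul_sub, ← mul_div_assoc, inv_mul_cancel₀ hΓ0.ne']
      rw [heq, abs_mul, abs_of_pos (inv_pos.2 hΓ0), inv_mul_le_iff₀ hΓ0]
      refine h.trans ?_
      have := mul_le_mul_of_nonneg_right hΓ hε.le
      linarith
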